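/- Let $a,b\ge 1$ be integers and consider the randomized complete block design (RCBD) mixed model $$y_{ij}=\mu+\alpha_i+\beta_j+e_{ij},\qquad i=1,\dots,a,\ j=1,\dots,b,$$ where $\mu,\alpha_1,\dots,\alpha_a$ are fixed real numbers, $\beta_j\sim N(0,\sigma^2_\beta)$ with $\sigma^2_\beta\ge 0$, $e_{ij}\sim N(0,\sigma^2)$ with $\sigma^2>0$, and all the variables $\beta_j$ and $e_{ij}$ are mutually independent. Let $\bar y_{i.}$, $\bar y_{.j}$, $\bar y_{..}$ be the means of the $y_{ij}$ over $j$, over $i$, and over both, let $\bar\alpha=\frac1a\sum_i\alpha_i$, and put $$SS_A=b\sum_{i=1}^a(\bar y_{i.}-\bar y_{..})^2,\quad SS_B=a\sum_{j=1}^b(\bar y_{.j}-\bar y_{..})^2,\quad SS_E=\sum_{i=1}^a\sum_{j=1}^b(y_{ij}-\bar y_{i.}-\bar y_{.j}+\bar y_{..})^2,\quad \gamma_A=b\sum_{i=1}^a(\alpha_i-\bar\alpha)^2 .$$ Here $\chi^2(p,\lambda)$ is the noncentral chi-square distribution, i.e. the law of $\sum_{i=1}^pX_i^2$ for independent $X_i\sim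 N(\delta_i,1)$ with $\sum_i\delta_i^2=\lambda$; $\chi^2(p)=\chi^2(p,0)$, and $\chi^2(0)$ is the point mass at $0$. $F(m,n,\lambda)$ is the law of $(U/m)/(V/n)$ with $U\sim\chi^2(m,\lambda)$ and $V\sim\chi^2(n)$ independent; $F(m,n)=F(m,n,0)$. Then $SS_A$, $SS_B$ and $SS_E$ are mutually independent, and $$SS_A\sim\sigma^2\chi^2(a-1,\gamma_A/\sigma^2),\qquad SS_B\sim(\sigma^2+a\sigma^2_\beta)\,\chi^2(b-1),\qquad SS_E\sim\sigma^2\chi^2((a-1)(b-1)).$$ If moreover $a,b\ge2$, then with $MS_A=SS_A/(a-1)$, $MS_B=SS_B/(b-1)$ and $MS_E=SS_E/[(a-1)(b-1)]$, $$F_A=\frac{MS_A}{MS_E}\sim F\bigl(a-1,(a-1)(b-1),\gamma_A/\sigma^2\bigr),\qquad F_B=\frac{MS_B}{MS_E}\sim\frac{\sigma^2+a\sigma^2_\beta}{\sigma^2}\,F\bigl(b-1,(a-1)(b-1)\bigr).$$ In particular, $F_A\sim F(a-1,(a-1)(b-1))$ if $\gamma_A=0$, and $F_B\sim F(b-1,(a-1)(b-1))$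 if $\sigma^2_\beta=0$. -/

import Mathlib

open MeasureTheory ProbabilityTheory
open scoped NNReal

namespace RCBD

noncomputable section

/-- The noncentral chi-square distribution `χ²(p, lam)` (with `lam ≥ 0`): the law of
`X₁² + ⋯ + X_p²` for independent `Xᵢ ~ N(δᵢ, 1)` with `∑ δᵢ² = lam`. This law depends on the mean
vector `δ` only through `lam`; the representative `δ = (√lam, 0, …, 0)` is used. -/
def noncentralChiSquare (p : ℕ) (lam : ℝ) : Measure ℝ :=
  (Measure.pi fun i : Fin p => gaussianReal (if (i : ℕ) = 0 then √lam else 0) 1).map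
    fun x => ∑ i, x i ^ 2

/-- The central chi-square distribution `χ²(p)`: the law of a sum of squares of `p` independent
standard normal variables. -/
def chiSquare (p : ℕ) : Measure ℝ :=
  (Measure.pi fun _ : Fin p => gaussianReal 0 1).map fun x => ∑ i, x i ^ 2

/-- The noncentral F distribution `F(m, n, lam)`: the law of `(U / m) / (V / n)` for independent
`U ~ χ²(m, lam)` and `V ~ χ²(n)`. -/
def noncentralF (m n : ℕ) (lam : ℝ) : Measure ℝ :=
  ((noncentralChiSquare m lam).prod (chiSquare n)).map fun q => (q.1 / m) / (q.2 / n)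

/-- The central F distribution `F(m, n)`. -/
def centralF (m n : ℕ) : Measure ℝ :=
  ((chiSquare m).prod (chiSquare n)).map fun q => (q.1 / m) / (q.2 / n)

/-- The law of `c * X` when `X` has law `ν`. -/
def scaled (c : ℝ) (ν : Measure ℝ) : Measure ℝ := ν.map fun x => c * x

variable {a b : ℕ}

/-- The mean of a finite family. -/
def mean {n : ℕ} (x : Fin n → ℝ) : ℝ := (∑ i, x i) / n

/-- The mean `ȳ_{i.}` of the observations at level `i` of factor A. -/
def rowMean (y : Fin a → Fin b → ℝ) (i : Fin a) : ℝ := (∑ j, y i j) / b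

/-- The mean `ȳ_{.j}` of the observations in block `j`. -/
def colMean (y : Fin a → Fin b → ℝ) (j : Fin b) : ℝ := (∑ i, y i j) / a

/-- The overall mean `ȳ_{..}`. -/
def grandMean (y : Fin a → Fin b → ℝ) : ℝ := (∑ i, ∑ j, y i j) / (a * b)

/-- The sum of squares due to factor A. -/
def SSA (y : Fin a → Fin b → ℝ) : ℝ := b * ∑ i, (rowMean y i - grandMean y) ^ 2

/-- The sum of squares due to the block factor B. -/
def SSB (y : Fin a → Fin b → ℝ) : ℝ := a * ∑ j, (colMean y j - grandMean y) ^ 2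

/-- The error sum of squares. -/
def SSE (y : Fin a → Fin b → ℝ) : ℝ :=
  ∑ i, ∑ j, (y i j - rowMean y i - colMean y j + grandMean y) ^ 2

/-- The mean squares. -/
def MSA (y : Fin a → Fin b → ℝ) : ℝ := SSA y / ((a : ℝ) - 1)

def MSB (y : Fin a → Fin b → ℝ) : ℝ := SSB y / ((b : ℝ) - 1)

def MSE (y : Fin a → Fin b → ℝ) : ℝ := SSE y / (((a : ℝ) - 1) * ((b : ℝ) - 1))

/-- The test statistics. -/
def FA (y : Fin a → Fin b → ℝ) : ℝ := MSA y / MSE y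

def FB (y : Fin a → Fin b → ℝ) : ℝ := MSB y / MSE y

/-- `γ_A = b ∑ᵢ (αᵢ - ᾱ)²`, where `b` is the number of blocks. -/
def gammaA (b : ℕ) (α : Fin a → ℝ) : ℝ := b * ∑ i, (α i - mean α) ^ 2

end

end RCBD

/-! Change coordinates orthogonally: with contrast matrices `U` and `V`, put `z (k, l) = ∑ i, ∑ j, U
k i * V l j * y i j`. By Parseval, SSA, SSB and SSE are the sums of `z ^ 2` over the disjoint blocks
`(k+1, 0)`, `(0, l+1)` and `(k+1, l+1)` (`SSA_eq_sum_sq`, `SSB_eq_sum_sq`, `SSE_eq_sum_sq`).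

The `z` are jointly Gaussian, and orthogonality makes them uncorrelated (`sum_coeff_mul_coeff`),
hence independent, even when the block variance is zero. Block effects survive only in coordinates
with row index `0`, so only SSB has the inflated variance. Fixed effects are constant in `j`, so
they survive only at column index `0`; aligning the first contrast of `U` with `α`
(`exists_isContrastMatrix`) puts all the noncentrality of SSA in one coordinate, as in
`noncentralChiSquare`. The F laws follow from independence. -/

namespace RCBD

/-! ### Contrast matrices. -/

/-- An orthogonal matrix whose first row is constant; its other rows are normalized contrasts. -/
structure IsContrastMatrix {n : ℕ} (U : Fin (n + 1) → Fin (n + 1) → ℝ) : Prop where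
  orthonormal : ∀ k k', ∑ i, U k i * U k' i = if k = k' then 1 else 0
  sum_sq : ∀ x : Fin (n + 1) → ℝ, ∑ k, (∑ i, U k i * x i) ^ 2 = ∑ i, x i ^ 2
  zero_apply : ∀ i, U 0 i = 1 / √((n + 1 : ℕ) : ℝ)

namespace IsContrastMatrix

variable {n : ℕ} {U : Fin (n + 1) → Fin (n + 1) → ℝ}

lemma sum_succ (hU : IsContrastMatrix U) (k : Fin n) : ∑ i, U k.succ i = 0 := by
  have h := hU.orthonormal k.succ 0
  simp_rw [hU.zero_apply, ← Finset.sum_mul] at h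
  rw [if_neg (Fin.succ_ne_zero k)] at h
  refine (mul_eq_zero.1 h).resolve_right ?_
  positivity

lemma sum_zero (hU : IsContrastMatrix U) : ∑ i, U 0 i = √((n + 1 : ℕ) : ℝ) := by
  simp only [hU.zero_apply, Finset.sum_const, Finset.card_univ, Fintype.card_fin, nsmul_eq_mul]
  rw [mul_one_div, Real.div_sqrt]

lemma sum_mul_const (hU : IsContrastMatrix U) (k : Fin n) (c : ℝ) : ∑ i, U k.succ i * c = 0 := by
  rw [← Finset.sum_mul, hU.sum_succ, zero_mul]

lemma sum_zero_mul (hU : IsContrastMatrix U) (x : Fin (n + 1) → ℝ) :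
    ∑ i, U 0 i * x i = (∑ i, x i) / √((n + 1 : ℕ) : ℝ) := by
  simp_rw [hU.zero_apply, ← Finset.mul_sum]
  ring

/-- Contrasts carry the whole sum of squares of a centred vector. -/
lemma sum_sq_succ (hU : IsContrastMatrix U) {x : Fin (n + 1) → ℝ} (hx : ∑ i, x i = 0) :
    ∑ k : Fin n, (∑ i, U k.succ i * x i) ^ 2 = ∑ i, x i ^ 2 := by
  rw [← hU.sum_sq, Fin.sum_univ_succ, hU.sum_zero_mul, hx]
  simp

end IsContrastMatrix

lemma sum_sub_mean {n : ℕ} (x : Fin (n + 1) → ℝ) : ∑ i, (x i - mean x) = 0 := by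
  simp only [mean, Finset.sum_sub_distrib, Finset.sum_const, Finset.card_univ, Fintype.card_fin,
    nsmul_eq_mul]
  rw [mul_div_cancel₀ _ (by positivity), sub_self]

open scoped RealInnerProductSpace in
/-- There is a contrast matrix whose first contrast is aligned with the centred vector `α - ᾱ`. -/
lemma exists_isContrastMatrix {n : ℕ} (α : Fin (n + 1) → ℝ) :
    ∃ U : Fin (n + 1) → Fin (n + 1) → ℝ, IsContrastMatrix U ∧
      ∀ k : Fin n, ∑ i, U k.succ i * α i =
        if (k : ℕ) = 0 then √(∑ i, (α i - mean α) ^ 2) else 0 := by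
  let c : EuclideanSpace ℝ (Fin (n + 1)) := WithLp.toLp 2 fun _ => 1 / √((n + 1 : ℕ) : ℝ)
  let d : EuclideanSpace ℝ (Fin (n + 1)) := WithLp.toLp 2 fun i => α i - mean α
  have hin (x z : EuclideanSpace ℝ (Fin (n + 1))) : ⟪x, z⟫ = ∑ i, x i * z i := by
    simp [PiLp.inner_apply, mul_comm]
  have hc : ⟪c, c⟫ = 1 := by
    rw [hin]
    simp only [c, Finset.sum_const, Finset.card_univ, Fintype.card_fin, nsmul_eq_mul]
    rw [← sq, div_pow, Real.sq_sqrt (by positivity)]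
    field_simp
  have hcd : ⟪c, d⟫ = 0 := by
    rw [hin]
    simp only [c, d]
    rw [← Finset.mul_sum, sum_sub_mean, mul_zero]
  have hdn : ‖d‖ = √(∑ i, (α i - mean α) ^ 2) := by
    rw [EuclideanSpace.norm_eq]
    simp [d]
  have key : ∃ B : OrthonormalBasis (Fin (n + 1)) ℝ (EuclideanSpace ℝ (Fin (n + 1))), B 0 = c ∧
      ∀ k : Fin n, ⟪B k.succ, d⟫ = if (k : ℕ) = 0 then ‖d‖ else 0 := by
    have hcard : Module.finrank ℝ (EuclideanSpace ℝ (Fin (n + 1))) = Fintype.card (Fin (n + 1)) := by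
      simp
    have hc' : ‖c‖ = 1 := by
      rw [norm_eq_sqrt_real_inner, hc, Real.sqrt_one]
    -- For constant `α` there is no direction to align with, and any completion of `c` works.
    by_cases hd : d = 0
    · obtain ⟨B, hB⟩ := Orthonormal.exists_orthonormalBasis_extension_of_card_eq hcard
        (v := fun _ => c) (s := {0}) (by
          constructor
          · intro i; simpa using hc'
          · intro i j hij; exact absurd (Subsingleton.elim i j) hij)
      exact ⟨B, hB 0 rfl, fun k => by simp [hd]⟩
    · have hd0 : ‖d‖ ≠ 0 := norm_ne_zero_iff.2 hd
      -- Only the values of `v` at indices `0` and `1` are prescribed; the basis is free elsewhere.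
      obtain ⟨B, hB⟩ := Orthonormal.exists_orthonormalBasis_extension_of_card_eq hcard
        (v := fun i => if i = 0 then c else ‖d‖⁻¹ • d) (s := {i | (i : ℕ) ≤ 1}) (by
          constructor
          · rintro ⟨i, hi⟩
            by_cases h : i = 0
            · simp [Set.domRestrict, h, hc']
            · simp [Set.domRestrict, h, norm_smul, hd0]
          · rintro ⟨i, hi⟩ ⟨j, hj⟩ hij
            have hij' : i ≠ j := fun h => hij (Subtype.ext h)
            simp only [Set.mem_ofPred_eq] at hi hj
            by_cases h : i = 0
            · have h' : j ≠ 0 := fun h' => hij' (h.trans h'.symm)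
              simp [Set.domRestrict, h, h', inner_smul_right, hcd]
            · have h' : j = 0 := by
                by_contra h'
                refine hij' (Fin.ext ?_)
                have := Fin.val_ne_zero_iff.2 h
                have := Fin.val_ne_zero_iff.2 h'
                omega
              simp [Set.domRestrict, h, h', inner_smul_left, real_inner_comm c d, hcd])
      refine ⟨B, by simpa using hB 0 (by simp), fun k => ?_⟩
      have hn : 0 < n := k.pos
      have h1 : B (Fin.succ ⟨0, hn⟩) = ‖d‖⁻¹ • d := by
        simpa using hB (Fin.succ ⟨0, hn⟩) (by simp)
      have h2 : d = ‖d‖ • B (Fin.succ ⟨0, hn⟩) := by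
        rw [h1, smul_smul, mul_inv_cancel₀ hd0, one_smul]
      have h3 : ⟪B k.succ, d⟫ = ‖d‖ * ⟪B k.succ, B (Fin.succ ⟨0, hn⟩)⟫ := by
        conv_lhs => rw [h2, inner_smul_right]
      rw [h3, orthonormal_iff_ite.1 B.orthonormal]
      by_cases hk : (k : ℕ) = 0 <;> simp [Fin.ext_iff, hk]
  obtain ⟨B, hB0, hB1⟩ := key
  have hU : IsContrastMatrix fun k i => B k i := by
    refine ⟨fun k k' => ?_, fun x => ?_, fun i => ?_⟩
    · rw [← hin, orthonormal_iff_ite.1 B.orthonormal]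
    · have := B.sum_sq_inner_right (WithLp.toLp 2 x)
      simpa [hin, EuclideanSpace.norm_sq_eq] using this
    · rw [hB0]
  refine ⟨_, hU, fun k => ?_⟩
  rw [← hdn, ← hB1, hin]
  simp only [d, mul_sub, Finset.sum_sub_distrib]
  rw [hU.sum_mul_const, sub_zero]

/-! ### Sums of squares in contrast coordinates. -/

variable {n m : ℕ} {U : Fin (n + 1) → Fin (n + 1) → ℝ} {V : Fin (m + 1) → Fin (m + 1) → ℝ}

lemma SSA_eq_sum_sq (hU : IsContrastMatrix U) (hV : IsContrastMatrix V)
    (y : Fin (n + 1) → Fin (m + 1) → ℝ) :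
    SSA y = ∑ k : Fin n, (∑ i, ∑ j, U k.succ i * V 0 j * y i j) ^ 2 := by
  have hm : (0 : ℝ) < ((m + 1 : ℕ) : ℝ) := by positivity
  have hn : (0 : ℝ) < ((n + 1 : ℕ) : ℝ) := by positivity
  have h0 : ∑ i, (rowMean y i - grandMean y) = 0 := by
    simp only [rowMean, grandMean, Finset.sum_sub_distrib, Finset.sum_const, Finset.card_univ,
      Fintype.card_fin, nsmul_eq_mul, ← Finset.sum_div]
    field_simp
    ring
  rw [SSA, ← hU.sum_sq_succ h0, Finset.mul_sum]
  refine Finset.sum_congr rfl fun k _ => ?_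
  have h1 : ∑ i, U k.succ i * (rowMean y i - grandMean y)
      = (∑ i, U k.succ i * ∑ j, y i j) / ((m + 1 : ℕ) : ℝ) := by
    simp only [mul_sub, Finset.sum_sub_distrib]
    rw [hU.sum_mul_const, sub_zero, Finset.sum_div]
    exact Finset.sum_congr rfl fun i _ => (mul_div_assoc _ _ _).symm
  have h2 : ∑ i, ∑ j, U k.succ i * V 0 j * y i j
      = (∑ i, U k.succ i * ∑ j, y i j) / √((m + 1 : ℕ) : ℝ) := by
    rw [Finset.sum_div]
    refine Finset.sum_congr rfl fun i _ => ?_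
    simp_rw [mul_assoc, ← Finset.mul_sum]
    rw [hV.sum_zero_mul, mul_div_assoc]
  rw [h1, h2, div_pow, div_pow, Real.sq_sqrt hm.le]
  field_simp

lemma SSB_eq_SSA_swap {a b : ℕ} (y : Fin a → Fin b → ℝ) : SSB y = SSA fun j i => y i j := by
  have : grandMean y = grandMean fun j i => y i j := by
    simp only [grandMean]
    rw [Finset.sum_comm, mul_comm]
  simp only [SSB, SSA, this]
  rfl

lemma SSB_eq_sum_sq (hU : IsContrastMatrix U) (hV : IsContrastMatrix V)
    (y : Fin (n + 1) → Fin (m + 1) → ℝ) :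
    SSB y = ∑ l : Fin m, (∑ i, ∑ j, U 0 i * V l.succ j * y i j) ^ 2 := by
  rw [SSB_eq_SSA_swap, SSA_eq_sum_sq hV hU]
  refine Finset.sum_congr rfl fun l _ => ?_
  rw [Finset.sum_comm]
  simp_rw [mul_comm (U 0 _)]

/-- The residuals have zero row sums, so contrasts in `j` lose nothing; the resulting vectors in `i`
are again centred, so contrasts in `i` lose nothing either. -/
lemma SSE_eq_sum_sq (hU : IsContrastMatrix U) (hV : IsContrastMatrix V)
    (y : Fin (n + 1) → Fin (m + 1) → ℝ) :
    SSE y = ∑ p : Fin n × Fin m, (∑ i, ∑ j, U p.1.succ i * V p.2.succ j * y i j) ^ 2 := by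
  have hm : (0 : ℝ) < ((m + 1 : ℕ) : ℝ) := by positivity
  have hn : (0 : ℝ) < ((n + 1 : ℕ) : ℝ) := by positivity
  have hrow (i : Fin (n + 1)) :
      ∑ j, (y i j - rowMean y i - colMean y j + grandMean y) = 0 := by
    simp only [rowMean, colMean, grandMean, Finset.sum_sub_distrib, Finset.sum_add_distrib,
      Finset.sum_const, Finset.card_univ, Fintype.card_fin, nsmul_eq_mul, ← Finset.sum_div]
    rw [Finset.sum_comm (f := fun j i => y i j)]
    field_simp
    ring
  have hV' (l : Fin m) (i : Fin (n + 1)) :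
      ∑ j, V l.succ j * (y i j - rowMean y i - colMean y j + grandMean y)
        = ∑ j, V l.succ j * (y i j - colMean y j) := by
    have (j : Fin (m + 1)) : V l.succ j * (y i j - rowMean y i - colMean y j + grandMean y)
        = V l.succ j * (y i j - colMean y j) + V l.succ j * (grandMean y - rowMean y i) := by ring
    simp_rw [this, Finset.sum_add_distrib]
    rw [hV.sum_mul_const, add_zero]
  have hcol (l : Fin m) : ∑ i, ∑ j, V l.succ j * (y i j - colMean y j) = 0 := by
    rw [Finset.sum_comm]
    refine Finset.sum_eq_zero fun j _ => ?_
    rw [← Finset.mul_sum]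
    simp only [colMean, Finset.sum_sub_distrib, Finset.sum_const, Finset.card_univ,
      Fintype.card_fin, nsmul_eq_mul]
    rw [mul_div_cancel₀ _ hn.ne', sub_self, mul_zero]
  rw [SSE, Fintype.sum_prod_type_right]
  simp_rw [← hV.sum_sq_succ (hrow _), hV']
  rw [Finset.sum_comm]
  refine Finset.sum_congr rfl fun l _ => ?_
  rw [← hU.sum_sq_succ (hcol l)]
  refine Finset.sum_congr rfl fun k _ => ?_
  congr 1
  simp only [mul_sub, Finset.sum_sub_distrib]
  rw [hU.sum_mul_const, sub_zero]
  simp_rw [Finset.mul_sum, mul_assoc]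

/-! ### Gaussian linear combinations and sums of squares. -/

section Gaussian

variable {Ω : Type*} [MeasurableSpace Ω] {P : Measure Ω} {S T : Type*} [Fintype S] [Fintype T]

/-- Linear combinations of independent centred Gaussian variables are jointly Gaussian. -/
lemma hasGaussianLaw_linearCombination {X : S → Ω → ℝ} {v : S → ℝ≥0}
    (hX : ∀ s, HasLaw (X s) (gaussianReal 0 (v s)) P) (hind : iIndepFun X P) (M : T → S → ℝ) :
    HasGaussianLaw (fun ω t => ∑ s, M t s * X s ω) P := by
  have h := hind.hasGaussianLaw fun s => (hX s).hasGaussianLaw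
  refine (h.map_fun (ContinuousLinearMap.pi fun t =>
    ∑ s, M t s • (ContinuousLinearMap.proj s : (S → ℝ) →L[ℝ] ℝ))).congr (.of_forall fun ω => ?_)
  ext t
  simp

lemma covariance_linearCombination [DecidableEq S] {X : S → Ω → ℝ} {v : S → ℝ≥0}
    (hX : ∀ s, HasLaw (X s) (gaussianReal 0 (v s)) P) (hind : iIndepFun X P) (c d : S → ℝ) :
    cov[fun ω => ∑ s, c s * X s ω, fun ω => ∑ s, d s * X s ω; P] = ∑ s, c s * d s * v s := by
  have := hind.isProbabilityMeasure
  have hL (s : S) : MemLp (X s) 2 P := (hX s).hasGaussianLaw.memLp_two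
  rw [covariance_fun_sum_fun_sum (fun s => (hL s).const_mul _) (fun s => (hL s).const_mul _)]
  refine Finset.sum_congr rfl fun s _ => ?_
  rw [Finset.sum_eq_single s]
  · rw [covariance_const_mul_left, covariance_const_mul_right, covariance_self (hX s).aemeasurable,
      (hX s).variance_eq, variance_id_gaussianReal]
    ring
  · intro s' _ hs
    rw [covariance_const_mul_left, covariance_const_mul_right,
      (hind.indepFun hs.symm).covariance_eq_zero (hL s) (hL s')]
    simp
  · simp

lemma hasLaw_linearCombination {X : S → Ω → ℝ} {v : S → ℝ≥0}
    (hX : ∀ s, HasLaw (X s) (gaussianReal 0 (v s)) P) (hind : iIndepFun X P) (c : S → ℝ) {w : ℝ≥0}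
    (hw : ∑ s, c s * c s * v s = w) :
    HasLaw (fun ω => ∑ s, c s * X s ω) (gaussianReal 0 w) P := by
  classical
  have h : HasGaussianLaw (fun ω => ∑ s, c s * X s ω) P :=
    (hasGaussianLaw_linearCombination hX hind fun _ : Unit => c).eval ()
  refine ⟨h.aemeasurable, ?_⟩
  rw [h.map_eq_gaussianReal]
  congr 1
  · rw [integral_finsetSum _ fun s _ => (hX s).hasGaussianLaw.integrable.const_mul _]
    refine Finset.sum_eq_zero fun s _ => ?_
    rw [integral_const_mul, (hX s).integral_eq, integral_id_gaussianReal, mul_zero]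
  · rw [← covariance_self h.aemeasurable, covariance_linearCombination hX hind, hw,
      Real.toNNReal_coe]

/-- Disjoint blocks of an uncorrelated Gaussian vector are independent. -/
lemma iIndepFun_blocks {γ : Type*} [Finite γ] {Z : T → Ω → ℝ}
    (hZ : HasGaussianLaw (fun ω t => Z t ω) P) (hcov : ∀ t t', t ≠ t' → cov[Z t, Z t'; P] = 0)
    {κ : γ → Type*} [∀ c, Finite (κ c)] (f : ∀ c, κ c → T)
    (hf : ∀ c c', c ≠ c' → ∀ i j, f c i ≠ f c' j) :
    iIndepFun (fun c ω (i : κ c) => Z (f c i) ω) P := by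
  have := Fintype.ofFinite γ
  have := fun c => Fintype.ofFinite (κ c)
  refine HasGaussianLaw.iIndepFun_of_covariance_eval ?_ fun c c' hc i j => hcov _ _ (hf c c' hc i j)
  exact hZ.map_fun (ContinuousLinearMap.pi fun c => ContinuousLinearMap.pi fun i : κ c =>
    (ContinuousLinearMap.proj (f c i) : (T → ℝ) →L[ℝ] ℝ))

/-- The sum of squares of independent `N(mᵢ, v)` variables. -/
lemma hasLaw_sum_sq {p : ℕ} (e : Fin p ≃ T) {Z : T → Ω → ℝ} {μ : T → ℝ} {v : ℝ≥0} (hv : 0 < v)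
    (hZ : ∀ t, HasLaw (Z t) (gaussianReal (μ t) v) P) (hind : iIndepFun Z P) :
    HasLaw (fun ω => ∑ t, Z t ω ^ 2)
      (scaled v ((Measure.pi fun i : Fin p => gaussianReal (μ (e i) / √v) 1).map
        fun x => ∑ i, x i ^ 2)) P := by
  have hv' : (0 : ℝ) < v := hv
  have h1 (i : Fin p) : HasLaw (fun ω => Z (e i) ω / √v) (gaussianReal (μ (e i) / √v) 1) P := by
    have h := gaussianReal_div_const (hZ (e i)) √v
    convert h using 2
    rw [eq_comm, div_eq_one_iff_eq]
    · ext; simp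
    · rw [← NNReal.coe_ne_zero]
      simp [hv.ne']
  have h2 : iIndepFun (fun i : Fin p => fun ω => Z (e i) ω / √v) P :=
    (hind.precomp e.injective).comp (fun _ x => x / √v) fun _ => by fun_prop
  have h3 := h2.hasLaw_pi h1
  have h4 : HasLaw (fun x : Fin p → ℝ => ∑ i, x i ^ 2)
      ((Measure.pi fun i : Fin p => gaussianReal (μ (e i) / √v) 1).map fun x => ∑ i, x i ^ 2)
      (Measure.pi fun i : Fin p => gaussianReal (μ (e i) / √v) 1) :=
    ⟨Measurable.aemeasurable (by fun_prop), rfl⟩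
  have h5 (ν : Measure ℝ) : HasLaw (fun x : ℝ => (v : ℝ) * x) (scaled v ν) ν :=
    ⟨by fun_prop, rfl⟩
  convert (h5 _).fun_comp (h4.fun_comp h3) using 2 with ω
  rw [Finset.mul_sum, ← e.sum_comp]
  refine Finset.sum_congr rfl fun i _ => ?_
  rw [div_pow, Real.sq_sqrt hv'.le, mul_div_cancel₀ _ hv'.ne']

end Gaussian

/-! ### Chi-square and F laws. -/

lemma noncentralChiSquare_zero (p : ℕ) : noncentralChiSquare p 0 = chiSquare p := by
  simp [noncentralChiSquare, chiSquare]

instance (p : ℕ) (lam : ℝ) : IsProbabilityMeasure (noncentralChiSquare p lam) :=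
  Measure.isProbabilityMeasure_map (Measurable.aemeasurable (by fun_prop))

instance (p : ℕ) : IsProbabilityMeasure (chiSquare p) :=
  Measure.isProbabilityMeasure_map (Measurable.aemeasurable (by fun_prop))

lemma scaled_one (ν : Measure ℝ) : scaled 1 ν = ν := by simp [scaled]

/-- The ratio of independent scaled variables, each divided by its degrees of freedom. -/
lemma hasLaw_ratio {Ω : Type*} [MeasurableSpace Ω] {P : Measure Ω} [IsProbabilityMeasure P]
    {X Y : Ω → ℝ} {ν ρ : Measure ℝ} [IsProbabilityMeasure ν] [IsProbabilityMeasure ρ] {c d : ℝ}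
    (hX : HasLaw X (scaled c ν) P) (hY : HasLaw Y (scaled d ρ) P) (hXY : IndepFun X Y P) (p q : ℝ) :
    HasLaw (fun ω => (X ω / p) / (Y ω / q))
      (scaled (c / d) ((ν.prod ρ).map fun z => (z.1 / p) / (z.2 / q))) P := by
  have h1 := hXY.hasLaw_prod hX hY
  have h2 : (scaled c ν).prod (scaled d ρ)
      = (ν.prod ρ).map (Prod.map (fun x => c * x) fun x => d * x) :=
    Measure.map_prod_map _ _ (by fun_prop) (by fun_prop)
  rw [h2] at h1
  have hm : Measurable fun z : ℝ × ℝ => (z.1 / p) / (z.2 / q) := by fun_prop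
  have h3 : HasLaw (fun z : ℝ × ℝ => (z.1 / p) / (z.2 / q))
      (scaled (c / d) ((ν.prod ρ).map fun z => (z.1 / p) / (z.2 / q)))
      ((ν.prod ρ).map (Prod.map (fun x => c * x) fun x => d * x)) := by
    refine ⟨hm.aemeasurable, ?_⟩
    rw [Measure.map_map hm (by fun_prop), scaled, Measure.map_map (by fun_prop) hm]
    congr 1
    ext z
    simp only [Function.comp_apply, Prod.map_fst, Prod.map_snd]
    -- Since `0⁻¹ = 0`, inversion is multiplicative everywhere, so zero denominators need no
    -- separate case.
    simp only [div_eq_mul_inv, mul_inv]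
    ring
  exact h3.fun_comp h1

/-! ### Means and covariances of the coordinates. -/

section Model

variable {n m : ℕ} {U : Fin (n + 1) → Fin (n + 1) → ℝ} {V : Fin (m + 1) → Fin (m + 1) → ℝ}

/-- The coefficients of the block effects and of the errors in the coordinates
`∑ᵢ ∑ⱼ U k i * V l j * y i j`. -/
def coeff (U : Fin (n + 1) → Fin (n + 1) → ℝ) (V : Fin (m + 1) → Fin (m + 1) → ℝ)
    (t : Fin (n + 1) × Fin (m + 1)) : Fin (m + 1) ⊕ Fin (n + 1) × Fin (m + 1) → ℝ :=
  Sum.elim (fun j => (∑ i, U t.1 i) * V t.2 j) fun q => U t.1 q.1 * V t.2 q.2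

/-- The variance of the coordinate with row index `k`. -/
def coordVar (n : ℕ) (σsq σβsq : ℝ≥0) (k : Fin (n + 1)) : ℝ≥0 :=
  if k = 0 then σsq + ((n + 1 : ℕ) : ℝ≥0) * σβsq else σsq

/-- The errors contribute `σsq` by orthonormality. The block effects carry the row sums of `U`,
which vanish except for row `0`, where the square is `n + 1`. -/
lemma sum_coeff_mul_coeff (hU : IsContrastMatrix U) (hV : IsContrastMatrix V) (σsq σβsq : ℝ≥0)
    (t t' : Fin (n + 1) × Fin (m + 1)) :
    ∑ s, coeff U V t s * coeff U V t' s *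
        (Sum.elim (fun _ => σβsq) (fun _ => σsq) s : ℝ≥0) =
      if t = t' then (coordVar n σsq σβsq t.1 : ℝ) else 0 := by
  obtain ⟨k, l⟩ := t
  obtain ⟨k', l'⟩ := t'
  simp only [coeff, Fintype.sum_sum_type, Sum.elim_inl, Sum.elim_inr, Fintype.sum_prod_type]
  have h1 : ∑ j, (∑ i, U k i) * V l j * ((∑ i, U k' i) * V l' j) * (σβsq : ℝ)
      = (∑ i, U k i) * (∑ i, U k' i) * σβsq * if l = l' then 1 else 0 := by
    rw [← hV.orthonormal, Finset.mul_sum]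
    exact Finset.sum_congr rfl fun j _ => by ring
  have h2 : ∑ i, ∑ j, U k i * V l j * (U k' i * V l' j) * (σsq : ℝ)
      = (σsq : ℝ) * (if k = k' then 1 else 0) * if l = l' then 1 else 0 := by
    rw [← hV.orthonormal, ← hU.orthonormal, mul_assoc, Finset.sum_mul_sum, Finset.mul_sum]
    refine Finset.sum_congr rfl fun i _ => ?_
    rw [Finset.mul_sum]
    exact Finset.sum_congr rfl fun j _ => by ring
  have hsum (k : Fin (n + 1)) : ∑ i, U k i = if k = 0 then √((n + 1 : ℕ) : ℝ) else 0 := by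
    induction k using Fin.cases with
    | zero => simpa using hU.sum_zero
    | succ k => simpa using hU.sum_succ k
  rw [h1, h2, hsum, hsum]
  have hsq : √((n + 1 : ℕ) : ℝ) * √((n + 1 : ℕ) : ℝ) = ((n + 1 : ℕ) : ℝ) :=
    Real.mul_self_sqrt (by positivity)
  by_cases hl : l = l'
  · by_cases hk : k = k'
    · subst hk hl
      by_cases h0 : k = 0
      · simp only [coordVar, h0, if_true, hsq]
        push_cast
        ring
      · simp [coordVar, h0]
    · by_cases h0 : k = 0
      · have : k' ≠ 0 := fun h => hk (h0.trans h.symm)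
        simp [hk, this]
      · simp [hk, h0]
  · simp [hl]

variable {Ω : Type*} {β : Fin (m + 1) → Ω → ℝ} {e : Fin (n + 1) → Fin (m + 1) → Ω → ℝ}

lemma coord_eq (U : Fin (n + 1) → Fin (n + 1) → ℝ) (V : Fin (m + 1) → Fin (m + 1) → ℝ)
    (t : Fin (n + 1) × Fin (m + 1)) (ξ : Fin (n + 1) → ℝ) (ω : Ω) :
    ∑ i, ∑ j, U t.1 i * V t.2 j * (ξ i + β j ω + e i j ω) =
      ∑ s, coeff U V t s * Sum.elim β (fun q : Fin (n + 1) × Fin (m + 1) => e q.1 q.2) s ω +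
        (∑ i, U t.1 i * ξ i) * ∑ j, V t.2 j := by
  simp only [coeff, Fintype.sum_sum_type, Sum.elim_inl, Sum.elim_inr, Fintype.sum_prod_type,
    mul_add, Finset.sum_add_distrib]
  have h1 : ∑ i, ∑ j, U t.1 i * V t.2 j * ξ i = (∑ i, U t.1 i * ξ i) * ∑ j, V t.2 j := by
    rw [Finset.sum_mul_sum]
    exact Finset.sum_congr rfl fun i _ => Finset.sum_congr rfl fun j _ => by ring
  have h2 : ∑ i, ∑ j, U t.1 i * V t.2 j * β j ω
      = ∑ j, (∑ i, U t.1 i) * V t.2 j * β j ω := by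
    rw [Finset.sum_comm]
    refine Finset.sum_congr rfl fun j _ => ?_
    rw [Finset.sum_mul, Finset.sum_mul]
  rw [h1, h2]
  ring

end Model

/-! ### The three blocks and the joint law of the sums of squares. -/

/-- The index sets of the coordinates entering `SSA`, `SSB` and `SSE`. -/
abbrev BlockIndex (n m : ℕ) : Fin 3 → Type
  | 0 => Fin n
  | 1 => Fin m
  | 2 => Fin n × Fin m

instance (n m : ℕ) : ∀ c, Fintype (BlockIndex n m c)
  | 0 => inferInstanceAs (Fintype (Fin n))
  | 1 => inferInstanceAs (Fintype (Fin m))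
  | 2 => inferInstanceAs (Fintype (Fin n × Fin m))

/-- The coordinates entering `SSA`, `SSB` and `SSE`. -/
def blockCoord (n m : ℕ) : ∀ c, BlockIndex n m c → Fin (n + 1) × Fin (m + 1)
  | 0 => fun k => (k.succ, 0)
  | 1 => fun l => (0, l.succ)
  | 2 => fun p => (p.1.succ, p.2.succ)

lemma blockCoord_injective (n m : ℕ) (c : Fin 3) : Function.Injective (blockCoord n m c) := by
  fin_cases c
  · intro k k' h
    simpa [blockCoord] using h
  · intro k k' h
    simpa [blockCoord] using h
  · intro k k' h
    simpa [blockCoord, Prod.ext_iff] using h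

lemma blockCoord_ne (n m : ℕ) (c c' : Fin 3) (h : c ≠ c') (i : BlockIndex n m c)
    (j : BlockIndex n m c') : blockCoord n m c i ≠ blockCoord n m c' j := by
  fin_cases c <;> fin_cases c' <;>
    simp_all [blockCoord, Fin.succ_ne_zero, (Fin.succ_ne_zero _).symm]

lemma hasLaw_SS_and_iIndepFun {Ω : Type*} [MeasurableSpace Ω] {P : Measure Ω} {n m : ℕ}
    (μ : ℝ) (α : Fin (n + 1) → ℝ) {σsq σβsq : ℝ≥0} (hσ : 0 < σsq)
    {β : Fin (m + 1) → Ω → ℝ} {e : Fin (n + 1) → Fin (m + 1) → Ω → ℝ}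
    (hβ : ∀ j, HasLaw (β j) (gaussianReal 0 σβsq) P)
    (he : ∀ i j, HasLaw (e i j) (gaussianReal 0 σsq) P)
    (hindep : iIndepFun (Sum.elim β fun q : Fin (n + 1) × Fin (m + 1) => e q.1 q.2) P)
    {y : Ω → Fin (n + 1) → Fin (m + 1) → ℝ} (hy : ∀ ω i j, y ω i j = μ + α i + β j ω + e i j ω) :
    iIndepFun ![fun ω => SSA (y ω), fun ω => SSB (y ω), fun ω => SSE (y ω)] P ∧
    HasLaw (fun ω => SSA (y ω))
      (scaled σsq (noncentralChiSquare n (gammaA (m + 1) α / σsq))) P ∧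
    HasLaw (fun ω => SSB (y ω))
      (scaled (σsq + ((n + 1 : ℕ) : ℝ) * σβsq) (chiSquare m)) P ∧
    HasLaw (fun ω => SSE (y ω)) (scaled σsq (chiSquare (n * m))) P := by
  obtain ⟨U, hU, hUα⟩ := exists_isContrastMatrix α
  -- No alignment is needed on the block side, so the vector is arbitrary.
  obtain ⟨V, hV, -⟩ := exists_isContrastMatrix fun _ : Fin (m + 1) => (0 : ℝ)
  let X := Sum.elim β fun q : Fin (n + 1) × Fin (m + 1) => e q.1 q.2
  have hX : ∀ s, HasLaw (X s)
      (gaussianReal 0 (Sum.elim (fun _ => σβsq) (fun _ => σsq) s : ℝ≥0)) P := by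
    rintro (j | q)
    · exact hβ j
    · exact he q.1 q.2
  let Z : Fin (n + 1) × Fin (m + 1) → Ω → ℝ := fun t ω => ∑ s, coeff U V t s * X s ω
  let μZ : Fin (n + 1) × Fin (m + 1) → ℝ := fun t =>
    (∑ i, U t.1 i * (μ + α i)) * ∑ j, V t.2 j
  have hcoord (t : Fin (n + 1) × Fin (m + 1)) (ω : Ω) :
      ∑ i, ∑ j, U t.1 i * V t.2 j * y ω i j = Z t ω + μZ t := by
    simp_rw [hy]
    exact coord_eq U V t (fun i => μ + α i) ω
  have hZ : HasGaussianLaw (fun ω t => Z t ω) P :=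
    hasGaussianLaw_linearCombination hX hindep (coeff U V)
  have hcov (t t' : Fin (n + 1) × Fin (m + 1)) (h : t ≠ t') : cov[Z t, Z t'; P] = 0 := by
    rw [covariance_linearCombination hX hindep, sum_coeff_mul_coeff hU hV, if_neg h]
  have hlaw (t : Fin (n + 1) × Fin (m + 1)) :
      HasLaw (fun ω => Z t ω + μZ t) (gaussianReal (μZ t) (coordVar n σsq σβsq t.1)) P := by
    have h := hasLaw_linearCombination hX hindep (coeff U V t) (w := coordVar n σsq σβsq t.1)
      (by rw [sum_coeff_mul_coeff hU hV, if_pos rfl])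
    have h' := gaussianReal_add_const h (μZ t)
    rwa [zero_add] at h'
  have hind : iIndepFun (fun t ω => Z t ω + μZ t) P :=
    (hZ.iIndepFun_of_covariance_eq_zero hcov).comp (fun t x => x + μZ t) fun _ => by fun_prop
  have hsub (c : Fin 3) := hind.precomp (blockCoord_injective n m c)
  have hA (ω : Ω) : SSA (y ω) =
      ∑ k : BlockIndex n m 0, (Z (blockCoord n m 0 k) ω + μZ (blockCoord n m 0 k)) ^ 2 := by
    simp_rw [SSA_eq_sum_sq hU hV, ← hcoord]
    rfl
  have hB (ω : Ω) : SSB (y ω) =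
      ∑ k : BlockIndex n m 1, (Z (blockCoord n m 1 k) ω + μZ (blockCoord n m 1 k)) ^ 2 := by
    simp_rw [SSB_eq_sum_sq hU hV, ← hcoord]
    rfl
  have hE (ω : Ω) : SSE (y ω) =
      ∑ k : BlockIndex n m 2, (Z (blockCoord n m 2 k) ω + μZ (blockCoord n m 2 k)) ^ 2 := by
    simp_rw [SSE_eq_sum_sq hU hV, ← hcoord]
    rfl
  have hVsucc (k : Fin (n + 1)) (l : Fin m) : μZ (k, l.succ) = 0 := by
    simp only [μZ, hV.sum_succ, mul_zero]
  have hσ' : (0 : ℝ) < σsq := hσ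
  refine ⟨?_, ?_, ?_, ?_⟩
  · have h := (iIndepFun_blocks hZ hcov (blockCoord n m) (blockCoord_ne n m)).comp
      (fun c x => ∑ i, (x i + μZ (blockCoord n m c i)) ^ 2)
      (fun c => by fun_prop)
    convert h using 1
    funext c ω
    fin_cases c
    · exact hA ω
    · exact hB ω
    · exact hE ω
  -- The factor `√(m + 1)` from row `0` of `V` turns the norm of the centred `α` into `√γ_A`.
  · have h1 (k : Fin n) : μZ (k.succ, 0) / √(σsq : ℝ) =
        if (k : ℕ) = 0 then √(gammaA (m + 1) α / σsq) else 0 := by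
      simp only [μZ, mul_add, Finset.sum_add_distrib, hU.sum_mul_const, hV.sum_zero, hUα, zero_add]
      split_ifs
      · rw [gammaA, Real.sqrt_div' _ hσ'.le, mul_comm, Real.sqrt_mul (by positivity)]
      · simp
    simp_rw [hA]
    convert hasLaw_sum_sq (Equiv.refl (Fin n)) (T := Fin n) (μ := fun k => μZ (k.succ, 0)) hσ
      (fun k => by simpa [coordVar, blockCoord] using hlaw (blockCoord n m 0 k)) (hsub 0) using 1
    simp only [h1, Equiv.refl_apply]
    rfl
  · simp_rw [hB]
    convert hasLaw_sum_sq (Equiv.refl (Fin m)) (T := Fin m) (μ := fun l => μZ (0, l.succ))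
      (v := σsq + ((n + 1 : ℕ) : ℝ≥0) * σβsq) (by positivity)
      (fun k => by simpa [coordVar, blockCoord] using hlaw (blockCoord n m 1 k)) (hsub 1) using 1
    simp only [hVsucc, zero_div]
    push_cast
    rfl
  · simp_rw [hE]
    convert hasLaw_sum_sq finProdFinEquiv.symm (T := Fin n × Fin m)
      (μ := fun p => μZ (p.1.succ, p.2.succ)) hσ
      (fun k => by simpa [coordVar, blockCoord] using hlaw (blockCoord n m 2 k)) (hsub 2) using 1
    simp only [hVsucc, zero_div]
    rfl

end RCBD

/-! ### The main theorem. -/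

theorem mainTheorem3 {Ω : Type*} [MeasurableSpace Ω] (P : Measure Ω) [IsProbabilityMeasure P]
    (a b : ℕ) (ha : 1 ≤ a) (hb : 1 ≤ b)
    -- overall mean, fixed effects of factor A, error variance `σ²` and block variance `σ²_β`
    (μ : ℝ) (α : Fin a → ℝ) (σsq σβsq : ℝ≥0) (hσ : 0 < σsq)
    -- random block effects and errors, all mutually independent
    (β : Fin b → Ω → ℝ) (e : Fin a → Fin b → Ω → ℝ)
    (hβ : ∀ j, HasLaw (β j) (gaussianReal 0 σβsq) P)
    (he : ∀ i j, HasLaw (e i j) (gaussianReal 0 σsq) P)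
    (hindep : iIndepFun
      (Sum.elim β fun q : Fin a × Fin b => e q.1 q.2 : Fin b ⊕ Fin a × Fin b → Ω → ℝ) P)
    -- the observations
    (y : Ω → Fin a → Fin b → ℝ)
    (hy : ∀ ω i j, y ω i j = μ + α i + β j ω + e i j ω) :
    iIndepFun ![fun ω => RCBD.SSA (y ω), fun ω => RCBD.SSB (y ω), fun ω => RCBD.SSE (y ω)] P ∧
    HasLaw (fun ω => RCBD.SSA (y ω))
      (RCBD.scaled σsq (RCBD.noncentralChiSquare (a - 1) (RCBD.gammaA b α / σsq))) P ∧
    HasLaw (fun ω => RCBD.SSB (y ω))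
      (RCBD.scaled (σsq + a * σβsq) (RCBD.chiSquare (b - 1))) P ∧
    HasLaw (fun ω => RCBD.SSE (y ω))
      (RCBD.scaled σsq (RCBD.chiSquare ((a - 1) * (b - 1)))) P ∧
    -- the F statistics make sense when all degrees of freedom are positive
    (2 ≤ a → 2 ≤ b →
      HasLaw (fun ω => RCBD.FA (y ω))
        (RCBD.noncentralF (a - 1) ((a - 1) * (b - 1)) (RCBD.gammaA b α / σsq)) P ∧
      HasLaw (fun ω => RCBD.FB (y ω))
        (RCBD.scaled ((σsq + a * σβsq) / σsq)
          (RCBD.centralF (b - 1) ((a - 1) * (b - 1)))) P ∧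
      -- null distributions
      (RCBD.gammaA b α = 0 →
        HasLaw (fun ω => RCBD.FA (y ω)) (RCBD.centralF (a - 1) ((a - 1) * (b - 1))) P) ∧
      (σβsq = 0 →
        HasLaw (fun ω => RCBD.FB (y ω)) (RCBD.centralF (b - 1) ((a - 1) * (b - 1))) P)) := by
  obtain ⟨n, rfl⟩ : ∃ n, a = n + 1 := ⟨a - 1, by omega⟩
  obtain ⟨m, rfl⟩ : ∃ m, b = m + 1 := ⟨b - 1, by omega⟩
  have hσ' : (σsq : ℝ) ≠ 0 := (NNReal.coe_pos.2 hσ).ne'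
  obtain ⟨hind, hA, hB, hE⟩ := RCBD.hasLaw_SS_and_iIndepFun μ α hσ hβ he hindep hy
  simp only [Nat.add_sub_cancel]
  refine ⟨hind, hA, hB, hE, fun _ _ => ?_⟩
  have hn : (((n + 1 : ℕ) : ℝ) - 1) = n := by push_cast; ring
  have hm : (((m + 1 : ℕ) : ℝ) - 1) = m := by push_cast; ring
  have hFA : HasLaw (fun ω => RCBD.FA (y ω))
      (RCBD.noncentralF n (n * m) (RCBD.gammaA (m + 1) α / σsq)) P := by
    have h := RCBD.hasLaw_ratio hA hE (hind.indepFun (i := 0) (j := 2) (by decide)) n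
      ((n * m : ℕ) : ℝ)
    rw [div_self hσ', RCBD.scaled_one] at h
    simpa only [RCBD.noncentralF, RCBD.FA, RCBD.MSA, RCBD.MSE, hn, hm, ← Nat.cast_mul] using h
  have hFB : HasLaw (fun ω => RCBD.FB (y ω))
      (RCBD.scaled ((σsq + (n + 1 : ℕ) * σβsq) / σsq) (RCBD.centralF m (n * m))) P := by
    have h := RCBD.hasLaw_ratio hB hE (hind.indepFun (i := 1) (j := 2) (by decide)) m
      ((n * m : ℕ) : ℝ)
    simpa only [RCBD.centralF, RCBD.FB, RCBD.MSB, RCBD.MSE, hn, hm, ← Nat.cast_mul] using h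
  refine ⟨hFA, hFB, fun hγ => ?_, fun hβ0 => ?_⟩
  · rwa [hγ, zero_div, RCBD.noncentralF, RCBD.noncentralChiSquare_zero] at hFA
  · rwa [hβ0, NNReal.coe_zero, mul_zero, add_zero, div_self hσ', RCBD.scaled_one] at hFB
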